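/- Let $$\mathbb{E}=\{(x_1,x_2,x_3)\in\mathbb{C}^3 : 1-x_1z-x_2w+x_3zw\neq 0 \text{ for all } z,w\in\mathbb{C} \text{ with } |z|\le 1,\ |w|\le 1\}$$ be the tetrablock. A set $\Omega_1$ is called an analytic retract of a set $\Omega_2$ (in complex normed spaces) if there are analytic maps $h:\Omega_1\to\Omega_2$ and $\kappa:\Omega_2\to\Omega_1$ with $\kappa\circ h=\mathrm{id}_{\Omega_1}$. A $J^*$-algebra is a closed complex subspace $\mathcal{A}$ of the Banach space $\mathcal{L}(H,K)$ of bounded linear operators, for some complex Hilbert spaces $H,K$, such that $T\in\mathcal{A}$ implies $TT^*T\in\mathcal{A}$; its rank is the supremum over $T\in\mathcal{A}$ of the number of non-zero elements of the spectrum of $T^*T$. A bounded symmetric domain is a bounded non-empty connected open set $\Omega\subset\mathbb{C}^n$ such that every $z\in\Omega$ is an isolated fixed point of some analytic map $s:\Omega\to\Omega$ with $s\circ s=\mathrm{id}_\Omega$. Then $\mathbb{E}$ is not an analytic retract of the open unit ball $\{T\in\mathcal{A}:\|T\|<1\}$ of any $J^*$-algebra $\mathcal{A}$ of finite rank. In particular,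 for $n<16$, $\mathbb{E}$ is not an analytic retract of any bounded symmetric domain $\Omega\subset\mathbb{C}^n$. -/

import Mathlib

open Set Filter Topology

/-- The tetrablock: the set of `x ∈ ℂ³` such that `1 - x₁ z - x₂ w + x₃ z w` has no zero
`(z, w)` in the closed bidisc. (The coordinates are indexed by `0, 1, 2`.) -/
def tetrablock : Set (Fin 3 → ℂ) :=
  {x | ∀ z w : ℂ, ‖z‖ ≤ 1 → ‖w‖ ≤ 1 → 1 - x 0 * z - x 1 * w + x 2 * (z * w) ≠ 0}

/-- `Ω₁` is an analytic retract of `Ω₂`: there are analytic maps `h : Ω₁ → Ω₂` and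
`κ : Ω₂ → Ω₁` such that `κ ∘ h` is the identity of `Ω₁`. -/
def IsAnalyticRetract {V W : Type*} [NormedAddCommGroup V] [NormedSpace ℂ V]
    [NormedAddCommGroup W] [NormedSpace ℂ W] (Ω₁ : Set V) (Ω₂ : Set W) : Prop :=
  ∃ (h : V → W) (κ : W → V),
    AnalyticOnNhd ℂ h Ω₁ ∧ MapsTo h Ω₁ Ω₂ ∧
    AnalyticOnNhd ℂ κ Ω₂ ∧ MapsTo κ Ω₂ Ω₁ ∧
    ∀ x ∈ Ω₁, κ (h x) = x

/-- A J*-algebra: a closed complex subspace `A` of the space of bounded linear operators between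
two complex Hilbert spaces such that `T ∈ A` implies `T T* T ∈ A`. -/
structure IsJStarAlgebra {H K : Type*} [NormedAddCommGroup H] [InnerProductSpace ℂ H]
    [CompleteSpace H] [NormedAddCommGroup K] [InnerProductSpace ℂ K] [CompleteSpace K]
    (A : Submodule ℂ (H →L[ℂ] K)) : Prop where
  isClosed : IsClosed (A : Set (H →L[ℂ] K))
  triple_mem : ∀ T ∈ A, T.comp ((ContinuousLinearMap.adjoint T).comp T) ∈ A

/-- The rank of a J*-algebra `A`: the supremum, over `T ∈ A`, of the number of non-zero elements
of the spectrum of `T* T`. -/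
noncomputable def jStarRank {H K : Type*} [NormedAddCommGroup H] [InnerProductSpace ℂ H]
    [CompleteSpace H] [NormedAddCommGroup K] [InnerProductSpace ℂ K] [CompleteSpace K]
    (A : Submodule ℂ (H →L[ℂ] K)) : ℕ∞ :=
  ⨆ T ∈ A, (spectrum ℂ ((ContinuousLinearMap.adjoint T).comp T) \ {0}).encard

/-- A bounded symmetric domain: a bounded, open, connected, non-empty set `Ω` such that every
`z ∈ Ω` is an isolated fixed point of some analytic involution of `Ω`. -/
structure IsBoundedSymmetricDomain {V : Type*} [NormedAddCommGroup V] [NormedSpace ℂ V]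
    (Ω : Set V) : Prop where
  isOpen : IsOpen Ω
  isConnected : IsConnected Ω
  isBounded : Bornology.IsBounded Ω
  symmetric : ∀ z ∈ Ω, ∃ s : V → V,
    AnalyticOnNhd ℂ s Ω ∧ MapsTo s Ω Ω ∧ (∀ w ∈ Ω, s (s w) = w) ∧
    s z = z ∧ ∀ᶠ w in 𝓝[≠] z, s w ≠ w

/-! Balls of J*-algebras and bounded symmetric domains have, at every point `w`, a holomorphic
self-map fixing `w` with derivative `-1`. If `κ ∘ h = id` exhibits the tetrablock as a retract of
such a domain and `s` is the symmetry at `h 0`, then `S = κ ∘ s ∘ h` is a self-map of the tetrablock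
with `S 0 = 0` and `S'(0) = -κ'h' = -1`. `tetrablock_no_symmetry` shows that no such `S` exists.

The obstruction is of second order. For `|y| = 1` the disc `z • tetrablockDisc y z` leaves the
origin in the direction `(y/2, y/2, y²/2)`, and its first coordinate is `y(z/2 - z²/4 + ...)`. By
`tetrablock_disc_second_coeff`, every disc in that direction has this same coefficient `-y/4`, so
the image of the disc under `S`, traversed backwards, has it too. Comparing with the Taylor
expansion of `S` gives its quadratic part `Q` (first coordinate): `Q(y/2, y/2, y²/2) = -y/2`, that
is, `y Q(1, 1, y) = -2` on the whole unit circle. The left side is a polynomial in `y` without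
constant term, so this is impossible.

Point symmetries come from `fderiv_eq_neg_id_of_isolated_fixedPoint` for symmetric domains, and from
the explicit map `ballSymm` for operator balls; `exists_symmetry_of_linearIsometry` shows that the
latter preserves the ball of a J*-algebra. -/

/-! ### Schwarz lemmas on the unit disc -/

/-- The coefficient form of the Schwarz-Pick inequality at the origin. -/
theorem norm_deriv_zero_le_one_sub_sq {ψ : ℂ → ℂ} {d : ℂ}
    (hd : DifferentiableOn ℂ ψ (Metric.ball 0 1)) (hb : ∀ z ∈ Metric.ball (0 : ℂ) 1, ‖ψ z‖ ≤ 1)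
    (h0 : HasDerivAt ψ d 0) : ‖d‖ ≤ 1 - ‖ψ 0‖ ^ 2 := by
  set c := ψ 0 with hc
  have hc1 : ‖c‖ ≤ 1 := hb 0 (by simp)
  have key : ∀ r : ℝ, 0 < r → r < 1 → r * ‖d‖ ≤ 1 - r ^ 2 * ‖c‖ ^ 2 := by
    -- Shrinking `ψ` to `rψ` keeps it strictly inside the disc, so the Möbius map sending `rψ(0)` to
    -- `0` has no pole; its composite `η` with `rψ` satisfies `|η'(0)| ≤ 1`. Afterwards `r → 1`.
    intro r hr0 hr1
    obtain ⟨b, hbdef⟩ : ∃ b : ℂ, b = r * c := ⟨_, rfl⟩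
    have hbn : ‖b‖ = r * ‖c‖ := by simp [hbdef, abs_of_pos hr0]
    have hb1 : ‖b‖ < 1 := by rw [hbn]; nlinarith [norm_nonneg c]
    have hden : ∀ z ∈ Metric.ball (0 : ℂ) 1, 1 - (starRingEnd ℂ) b * (r * ψ z) ≠ 0 := by
      intro z hz h
      have h1 : (starRingEnd ℂ) b * (r * ψ z) = 1 := (sub_eq_zero.mp h).symm
      have h2 : ‖(starRingEnd ℂ) b * (r * ψ z)‖ < 1 := by
        rw [norm_mul, RCLike.norm_conj, norm_mul, Complex.norm_real, Real.norm_of_nonneg hr0.le]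
        have := hb z hz
        have : r * ‖ψ z‖ ≤ 1 := by nlinarith [norm_nonneg (ψ z)]
        nlinarith [norm_nonneg b]
      rw [h1] at h2; simp at h2
    let η : ℂ → ℂ := fun z => (r * ψ z - b) / (1 - (starRingEnd ℂ) b * (r * ψ z))
    have hη0 : η 0 = 0 := by simp [η, hbdef, hc]
    have hηd : DifferentiableOn ℂ η (Metric.ball 0 1) :=
      ((hd.const_mul _).sub_const _).div ((hd.const_mul _ |>.const_mul _).const_sub _) hden
    have hηm : MapsTo η (Metric.ball 0 1) (Metric.closedBall (η 0) 1) := by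
      intro z hz
      rw [hη0, mem_closedBall_zero_iff, norm_div]
      apply div_le_one_of_le₀ _ (norm_nonneg _)
      have hψ : ‖(r : ℂ) * ψ z‖ ≤ 1 := by
        rw [norm_mul, Complex.norm_real, Real.norm_of_nonneg hr0.le]
        have := hb z hz
        nlinarith [norm_nonneg (ψ z)]
      generalize (r : ℂ) * ψ z = a at hψ
      rw [← sq_le_sq₀ (norm_nonneg _) (norm_nonneg _), ← Complex.normSq_eq_norm_sq,
        ← Complex.normSq_eq_norm_sq]
      have ha2 : Complex.normSq a ≤ 1 := by
        rw [Complex.normSq_eq_norm_sq]; nlinarith [norm_nonneg a]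
      have hb2 : Complex.normSq b ≤ 1 := by
        rw [Complex.normSq_eq_norm_sq]; nlinarith [norm_nonneg b]
      rw [Complex.normSq_apply] at *
      simp only [Complex.normSq_apply, Complex.sub_re, Complex.sub_im, Complex.mul_re,
        Complex.mul_im, Complex.conj_re, Complex.conj_im, Complex.one_re, Complex.one_im] at *
      nlinarith [mul_nonneg (sub_nonneg.mpr ha2) (sub_nonneg.mpr hb2)]
    have hder : HasDerivAt η (r * d / (1 - r ^ 2 * ‖c‖ ^ 2)) 0 := by
      have h0' := hden 0 (by simp)
      have hbc : (starRingEnd ℂ) b * (r * ψ 0) = r ^ 2 * ‖c‖ ^ 2 := by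
        rw [← Complex.conj_mul', hbdef, ← hc]; simp; ring
      have := ((h0.const_mul (r : ℂ)).sub_const b).div
        (((h0.const_mul (r : ℂ)).const_mul ((starRingEnd ℂ) b)).const_sub 1) h0'
      refine this.congr_deriv ?_
      rw [hbc] at h0' ⊢
      have hz : (r : ℂ) * ψ 0 - b = 0 := by simp [hbdef, hc]
      rw [hz]
      field_simp
      ring
    have h1 := Complex.norm_deriv_le_one_of_mapsTo_ball hηd hηm one_pos
    rw [hder.deriv, norm_div, norm_mul, Complex.norm_real, Real.norm_of_nonneg hr0.le] at h1
    have hpos : 0 < 1 - r ^ 2 * ‖c‖ ^ 2 := by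
      rw [← mul_pow, ← hbn]; nlinarith [norm_nonneg b]
    have h2 : ‖(1 : ℂ) - r ^ 2 * ‖c‖ ^ 2‖ = 1 - r ^ 2 * ‖c‖ ^ 2 := by
      rw [← Real.norm_of_nonneg hpos.le, ← Complex.norm_real]; push_cast; rfl
    rwa [h2, div_le_one hpos] at h1
  have hT1 : Tendsto (fun r : ℝ => r * ‖d‖) (𝓝[<] 1) (𝓝 (1 * ‖d‖)) :=
    (Continuous.tendsto (by fun_prop) 1).mono_left nhdsWithin_le_nhds
  have hT2 : Tendsto (fun r : ℝ => 1 - r ^ 2 * ‖c‖ ^ 2) (𝓝[<] 1) (𝓝 (1 - 1 ^ 2 * ‖c‖ ^ 2)) :=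
    (Continuous.tendsto (by fun_prop) 1).mono_left nhdsWithin_le_nhds
  have := le_of_tendsto_of_tendsto hT1 hT2 (by
    filter_upwards [Ioo_mem_nhdsLT (show (0 : ℝ) < 1 by norm_num)] with r hr
    exact key r hr.1 hr.2)
  simpa using this

/-- The second-order Schwarz lemma. -/
theorem norm_second_coeff_le {φ C : ℂ → ℂ} {a : ℂ}
    (hd : DifferentiableOn ℂ φ (Metric.ball 0 1)) (hb : ∀ z ∈ Metric.ball (0 : ℂ) 1, ‖φ z‖ ≤ 1)
    (hC : ContinuousAt C 0) (h : ∀ z ∈ Metric.ball (0 : ℂ) 1, φ z = a * z + z ^ 2 * C z) :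
    ‖C 0‖ ≤ 1 - ‖a‖ ^ 2 := by
  have hφ0 : φ 0 = 0 := by simpa using h 0 (by simp)
  -- The quotient `φ(z)/z = a + z C(z)` is bounded by `1` by the Schwarz lemma, and its derivative
  -- at `0` is `C 0`, so the first-order inequality applies to it.
  have hder : HasDerivAt (fun z => a + z * C z) (C 0) 0 := by
    rw [hasDerivAt_iff_tendsto_slope]
    refine (hC.tendsto.mono_left nhdsWithin_le_nhds).congr' ?_
    filter_upwards [self_mem_nhdsWithin] with z hz
    have hz : z ≠ 0 := hz
    simp [slope_def_field, hz]
  have := norm_deriv_zero_le_one_sub_sq (ψ := fun z => a + z * C z) (d := C 0) ?_ ?_ hder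
  · simpa using this
  · intro z hz
    rcases eq_or_ne z 0 with rfl | hne
    · exact hder.differentiableAt.differentiableWithinAt
    · have h1 : DifferentiableAt ℂ (fun z => φ z / z) z :=
        (hd.differentiableAt (Metric.isOpen_ball.mem_nhds hz)).div differentiableAt_id hne
      refine (h1.congr_of_eventuallyEq ?_).differentiableWithinAt
      filter_upwards [Metric.isOpen_ball.mem_nhds hz, isOpen_ne.mem_nhds hne] with y hy hy0
      have hy0 : y ≠ 0 := hy0
      rw [h y hy]; field_simp
  · intro z hz
    have key : ∀ y ∈ Metric.ball (0 : ℂ) 1, y ≠ 0 → ‖a + y * C y‖ ≤ 1 := by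
      intro y hy hy0
      have h1 : ‖φ y‖ ≤ ‖y‖ := Complex.norm_le_norm_of_mapsTo_ball hd
        (fun w hw => by simpa using hb w hw) hφ0 (by simpa using hy)
      have h2 : a + y * C y = φ y / y := by rw [h y hy]; field_simp
      rw [h2, norm_div]
      exact div_le_one_of_le₀ h1 (norm_nonneg _)
    rcases eq_or_ne z 0 with rfl | hne
    · have ht : Tendsto (fun y => ‖a + y * C y‖) (𝓝[≠] 0) (𝓝 ‖a + 0 * C 0‖) :=
        (hder.continuousAt.norm).tendsto.mono_left nhdsWithin_le_nhds
      refine le_of_tendsto ht ?_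
      filter_upwards [self_mem_nhdsWithin,
        nhdsWithin_le_nhds (Metric.isOpen_ball.mem_nhds hz)] with y hy0 hy
      exact key y hy hy0
    · exact key z hz hne

/-! ### Second-order rigidity of discs in the tetrablock -/

/-- For fixed `w = ω` the defining polynomial is affine in `z`; if the inequality failed, its root
would lie in the disc. Hence `x ↦ (x₀ - ωx₂)/(1 - ωx₁)` maps the tetrablock into the closed disc,
which makes one-variable Schwarz lemmas available. -/
theorem tetrablock_norm_sub_le {x : Fin 3 → ℂ} (hx : x ∈ tetrablock) {ω : ℂ} (hω : ‖ω‖ ≤ 1) :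
    1 - ω * x 1 ≠ 0 ∧ ‖x 0 - ω * x 2‖ ≤ ‖1 - ω * x 1‖ := by
  refine ⟨fun h => hx 0 ω (by simp) hω (by linear_combination h), ?_⟩
  by_contra! hlt
  have hne : x 0 - ω * x 2 ≠ 0 := norm_pos_iff.mp ((norm_nonneg _).trans_lt hlt)
  refine hx ((1 - ω * x 1) / (x 0 - ω * x 2)) ω ?_ hω ?_
  · rw [norm_div]; exact div_le_one_of_le₀ hlt.le (norm_nonneg _)
  · field_simp; ring

/-- The second Taylor coefficient of an analytic disc in the tetrablock through the origin in the
direction `(1/2, 1/2, 1/2)` is determined by the second-order Schwarz lemma. -/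
theorem tetrablock_disc_second_coeff {f B : ℂ → Fin 3 → ℂ}
    (hd : DifferentiableOn ℂ f (Metric.ball 0 1)) (hf : MapsTo f (Metric.ball 0 1) tetrablock)
    (hB : ContinuousAt B 0)
    (h : ∀ z ∈ Metric.ball (0 : ℂ) 1, ∀ i, f z i = 1 / 2 * z + z ^ 2 * B z i) :
    B 0 0 = -1 / 4 := by
  have hBi : ∀ i, ContinuousAt (fun z => B z i) 0 := fun i => continuousAt_pi.mp hB i
  have hdi : ∀ i, DifferentiableOn ℂ (fun z => f z i) (Metric.ball 0 1) :=
    fun i => differentiableOn_pi.mp hd i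
  have hf0 : ∀ i, f 0 i = 0 := fun i => by simpa using h 0 (by simp) i
  -- Second-order Schwarz lemma for `(f₀ - ωf₂)/(1 - ωf₁)`, whose linear coefficient is `(1 - ω)/2`.
  have key : ∀ ω : ℂ, ‖ω‖ = 1 → ‖B 0 0 - ω * B 0 2 + ω * (1 / 2) * (1 / 2 - ω / 2)‖
      ≤ 1 - ‖1 / 2 - ω / 2‖ ^ 2 := by
    intro ω hω
    have hE : ∀ z ∈ Metric.ball (0 : ℂ) 1, _ := fun z hz => tetrablock_norm_sub_le (hf hz) hω.le
    have := norm_second_coeff_le (φ := fun z => (f z 0 - ω * f z 2) / (1 - ω * f z 1))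
      (C := fun z => (B z 0 - ω * B z 2 + ω * (1 / 2 - ω / 2) * (1 / 2 + z * B z 1))
        / (1 - ω * f z 1)) (a := 1 / 2 - ω / 2) ?_ ?_ ?_ ?_
    · refine le_trans (le_of_eq ?_) this
      rw [hf0]; congr 1; simp; ring
    · exact ((hdi 0).sub ((hdi 2).const_mul ω)).div (((hdi 1).const_mul ω).const_sub 1)
        fun z hz => (hE z hz).1
    · intro z hz
      rw [norm_div]
      exact div_le_one_of_le₀ (hE z hz).2 (norm_nonneg _)
    · have hfc : ContinuousAt (fun z => f z 1) 0 :=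
        ((hdi 1).differentiableAt (Metric.ball_mem_nhds 0 one_pos)).continuousAt
      have h0 := hBi 0
      have h1 := hBi 1
      have h2 := hBi 2
      refine ContinuousAt.div (by fun_prop) (by fun_prop) (hE 0 (by simp)).1
    · intro z hz
      have hne := (hE z hz).1
      rw [eq_comm, ← sub_eq_zero]
      field_simp
      rw [h z hz 0, h z hz 1, h z hz 2]
      ring
  -- At `ω = -1` the linear coefficient is `1`, so the bound is `0` and the inequality becomes an
  -- equation.
  have hk : B 0 2 = 1 / 2 - B 0 0 := by
    have := key (-1) (by simp)
    norm_num at this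
    linear_combination this
  -- With this equation the left side of `key` has a factor `1 + ω`, while the right side is `|1 +
  -- ω|²/4`. Dividing once leaves a bound that tends to `0` as `ω → -1`.
  have hω : ∀ θ : ℝ, Complex.exp (θ * Complex.I) ≠ -1 →
      ‖B 0 0 + 1 / 4‖ ≤ 1 / 2 * ‖1 + Complex.exp (θ * Complex.I)‖ := by
    intro θ hne
    have hn := Complex.norm_exp_ofReal_mul_I θ
    generalize Complex.exp (θ * Complex.I) = ω at hne hn
    have h1 := key ω hn
    have hpos : 0 < ‖1 + ω‖ := norm_pos_iff.mpr fun h => hne (by linear_combination h)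
    have h2 : 1 - ‖1 / 2 - ω / 2‖ ^ 2 = 1 / 4 * ‖1 + ω‖ ^ 2 := by
      have hn2 : ‖ω‖ ^ 2 = 1 := by rw [hn]; norm_num
      rw [← Complex.normSq_eq_norm_sq, Complex.normSq_apply] at hn2 ⊢
      rw [← Complex.normSq_eq_norm_sq, Complex.normSq_apply]
      norm_num
      linarith
    rw [h2, hk, show B 0 0 - ω * (1 / 2 - B 0 0) + ω * (1 / 2) * (1 / 2 - ω / 2)
      = (1 + ω) * (B 0 0 - ω / 4) by ring, norm_mul] at h1
    have h3 : ‖B 0 0 - ω / 4‖ ≤ 1 / 4 * ‖1 + ω‖ := by nlinarith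
    calc ‖B 0 0 + 1 / 4‖ = ‖(B 0 0 - ω / 4) + (1 + ω) / 4‖ := by congr 1; ring
      _ ≤ ‖B 0 0 - ω / 4‖ + ‖(1 + ω) / 4‖ := norm_add_le _ _
      _ ≤ _ := by rw [norm_div]; norm_num; linarith
  have hcont : Tendsto (fun θ : ℝ => 1 / 2 * ‖1 + Complex.exp (θ * Complex.I)‖) (𝓝[<] Real.pi)
      (𝓝 (1 / 2 * ‖1 + Complex.exp (Real.pi * Complex.I)‖)) :=
    (Continuous.tendsto (by fun_prop) _).mono_left nhdsWithin_le_nhds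
  have hle := ge_of_tendsto hcont (b := ‖B 0 0 + 1 / 4‖) (by
    filter_upwards [Ioo_mem_nhdsLT Real.pi_pos] with θ hθ
    refine hω θ fun h => ?_
    have h1 := congrArg Complex.im h
    rw [Complex.exp_ofReal_mul_I_im] at h1
    have := Real.sin_pos_of_mem_Ioo hθ
    simp at h1
    linarith)
  rw [Complex.exp_pi_mul_I] at hle
  simp only [add_neg_cancel, norm_zero, mul_zero] at hle
  have := norm_le_zero_iff.mp hle
  linear_combination this

/-- The second-order Taylor expansion of an analytic function along a curve `z ↦ z • e z`. -/
theorem AnalyticAt.exists_tendsto_second_order {V : Type*} [NormedAddCommGroup V]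
    [NormedSpace ℂ V] {F : V → ℂ} {F' : V →L[ℂ] ℂ} (hF : AnalyticAt ℂ F 0)
    (hF' : HasFDerivAt F F' 0) :
    ∃ Q : ContinuousMultilinearMap ℂ (fun _ : Fin 2 => V) ℂ, ∀ e : ℂ → V, ContinuousAt e 0 →
      Tendsto (fun z => (F (z • e z) - F 0 - z * F' (e z)) / z ^ 2) (𝓝[≠] 0)
        (𝓝 (Q fun _ => e 0)) := by
  obtain ⟨p, hp⟩ := hF
  refine ⟨p 2, fun e he => ?_⟩
  have hcurve : Tendsto (fun z : ℂ => z • e z) (𝓝[≠] 0) (𝓝 0) := by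
    have : ContinuousAt (fun z : ℂ => z • e z) 0 := continuousAt_id.smul he
    simpa using this.tendsto.mono_left nhdsWithin_le_nhds
  have h0 := hp.coeff_zero (fun _ => 0)
  have h1 : ∀ y, p 1 (fun _ => y) = F' y := by
    intro y
    rw [hF'.unique hp.hasFDerivAt]
    simp only [continuousMultilinearCurryFin1_apply]
    congr 1
  have hO := (hp.isBigO_sub_partialSum_pow 3).comp_tendsto hcurve
  obtain ⟨c, hc⟩ := hO.bound
  have hQ : Tendsto (fun z => p 2 fun _ => e z) (𝓝[≠] 0) (𝓝 (p 2 fun _ => e 0)) := by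
    have : ContinuousAt (fun z => p 2 fun _ => e z) 0 :=
      (p 2).cont.continuousAt.comp (continuousAt_pi.mpr fun _ => he)
    exact this.tendsto.mono_left nhdsWithin_le_nhds
  refine hQ.congr_dist ?_
  have hz : Tendsto (fun z : ℂ => c * ‖z‖ * ‖e z‖ ^ 3) (𝓝[≠] 0)
      (𝓝 (c * ‖(0 : ℂ)‖ * ‖e 0‖ ^ 3)) := by
    have : ContinuousAt (fun z : ℂ => c * ‖z‖ * ‖e z‖ ^ 3) 0 := by fun_prop
    exact this.tendsto.mono_left nhdsWithin_le_nhds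
  rw [norm_zero, mul_zero, zero_mul] at hz
  refine squeeze_zero' (Eventually.of_forall fun _ => dist_nonneg) ?_ hz
  filter_upwards [hc, self_mem_nhdsWithin] with z hcz hz0
  have hz0 : z ≠ 0 := hz0
  have hsum : p.partialSum 3 (z • e z) = F 0 + z * F' (e z) + z ^ 2 * p 2 (fun _ => e z) := by
    rw [FormalMultilinearSeries.partialSum, Finset.sum_range_succ, Finset.sum_range_succ,
      Finset.sum_range_one, h1]
    congr 1
    · congr 1
      · rw [← h0]; congr 1; ext i; exact i.elim0
      · simp
    · rw [(p 2).map_smul_univ (fun _ => z) (fun _ => e z)]; simp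
  simp only [Function.comp_apply, zero_add, hsum, norm_smul, norm_mul, norm_pow, norm_norm] at hcz
  rw [dist_comm, dist_eq_norm]
  have : (F (z • e z) - F 0 - z * F' (e z)) / z ^ 2 - p 2 (fun _ => e z)
      = (F (z • e z) - (F 0 + z * F' (e z) + z ^ 2 * p 2 (fun _ => e z))) / z ^ 2 := by
    field_simp; ring
  rw [this, norm_div, norm_pow, div_le_iff₀ (by positivity)]
  refine hcz.trans (le_of_eq ?_)
  ring

/-! ### Extremal discs and elementary geometry of the tetrablock -/

/-- This puts the extremal discs inside the tetrablock. At a zero, isolating `z` and using `|z| ≤ 1`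
gives `|2 + l - lw|² ≤ |l|²|1 - (2l + 1)w|²`. With `r = |l|` and `q = |lw|`, a quarter of the
difference of the two sides is at least `(1 - q)(1 - r)(1 - qr) + (1 - q²)(Re l + r) > 0`. -/
theorem tetrablock_disc_denominator_ne_zero {l z w : ℂ} (hl : ‖l‖ < 1) (hz : ‖z‖ ≤ 1)
    (hw : ‖w‖ ≤ 1) : (2 + l) - l * (z + w) + l * (2 * l + 1) * (z * w) ≠ 0 := by
  intro h
  have h1 : 2 + l - l * w = l * z * (1 - (2 * l + 1) * w) := by linear_combination h
  have h2 : Complex.normSq (2 + l - l * w)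
      ≤ Complex.normSq l * Complex.normSq (1 - (2 * l + 1) * w) := by
    have : Complex.normSq z ≤ 1 := by
      rw [Complex.normSq_eq_norm_sq]; nlinarith [norm_nonneg z]
    rw [h1, Complex.normSq_mul, Complex.normSq_mul]
    have h3 := Complex.normSq_nonneg l
    have h4 := Complex.normSq_nonneg (1 - (2 * l + 1) * w)
    nlinarith [mul_nonneg h3 h4]
  obtain ⟨q, hq⟩ : ∃ q, q = ‖l * w‖ := ⟨_, rfl⟩
  obtain ⟨r, hr⟩ : ∃ r, r = ‖l‖ := ⟨_, rfl⟩
  have hr0 : 0 ≤ r := hr ▸ norm_nonneg _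
  have hq0 : 0 ≤ q := hq ▸ norm_nonneg _
  have hqr : q ≤ r := by rw [hq, hr, norm_mul]; nlinarith [norm_nonneg l]
  have hre : (l * w).re ≤ q := hq ▸ Complex.re_le_norm _
  have hx : -r ≤ l.re := by
    have := Complex.abs_re_le_norm l
    rw [← hr] at this
    exact (abs_le.mp this).1
  have hr2 : r ^ 2 = l.re * l.re + l.im * l.im := by
    rw [hr, ← Complex.normSq_eq_norm_sq, Complex.normSq_apply]
  have hq2 : q ^ 2 = (l.re * l.re + l.im * l.im) * (w.re * w.re + w.im * w.im) := by
    rw [hq, ← Complex.normSq_eq_norm_sq, Complex.normSq_mul, Complex.normSq_apply,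
      Complex.normSq_apply]
  have h3 : (1 + l.re) - q ^ 2 * (r ^ 2 + l.re) - (1 - r ^ 2) * (l * w).re ≤ 0 := by
    rw [hq2, hr2]
    simp only [Complex.normSq_apply, Complex.sub_re, Complex.sub_im, Complex.mul_re,
      Complex.mul_im, Complex.add_re, Complex.add_im, Complex.one_re, Complex.one_im,
      Complex.re_ofNat, Complex.im_ofNat] at h2 ⊢
    linarith
  have hr1 : r < 1 := hr ▸ hl
  have h4 : (1 - r ^ 2) * (l * w).re ≤ (1 - r ^ 2) * q :=
    mul_le_mul_of_nonneg_left hre (by nlinarith)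
  have h5 : 0 < (1 - q) * ((1 - r) * (1 - q * r)) :=
    mul_pos (by linarith) (mul_pos (by linarith) (by nlinarith))
  have h6 : 0 ≤ (1 - q) * (1 + q) * (l.re + r) :=
    mul_nonneg (mul_nonneg (by linarith) (by linarith)) (by linarith)
  nlinarith

/-- Extremal discs in the tetrablock through the origin, divided by the parameter. -/
noncomputable def tetrablockDisc (y l : ℂ) : Fin 3 → ℂ :=
  ![y / (2 + l), y / (2 + l), y ^ 2 * (2 * l + 1) / (2 + l)]

theorem two_add_ne_zero {l : ℂ} (hl : ‖l‖ < 1) : 2 + l ≠ 0 := by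
  intro h
  have : l = -2 := by linear_combination h
  rw [this] at hl
  norm_num at hl

theorem smul_tetrablockDisc_mem {y l : ℂ} (hy : ‖y‖ = 1) (hl : ‖l‖ < 1) :
    l • tetrablockDisc y l ∈ tetrablock := by
  intro z w hz hw h
  have h2 := two_add_ne_zero hl
  refine tetrablock_disc_denominator_ne_zero hl (z := y * z) (w := y * w) (by simpa [hy])
    (by simpa [hy]) ?_
  simp only [tetrablockDisc, Pi.smul_apply, smul_eq_mul, Matrix.cons_val_zero,
    Matrix.cons_val_one, Matrix.cons_val] at h
  field_simp at h
  linear_combination h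

theorem tetrablock_rotate_mem {x : Fin 3 → ℂ} (hx : x ∈ tetrablock) {y : ℂ} (hy : ‖y‖ = 1) :
    ![y * x 0, y * x 1, y ^ 2 * x 2] ∈ tetrablock := by
  intro z w hz hw h
  refine hx (y * z) (y * w) (by simpa [hy]) (by simpa [hy]) ?_
  simp only [Matrix.cons_val_zero, Matrix.cons_val_one, Matrix.cons_val] at h
  linear_combination h

theorem zero_mem_tetrablock : (0 : Fin 3 → ℂ) ∈ tetrablock := by
  intro z w _ _; simp

theorem tetrablock_mem_nhds_zero : tetrablock ∈ 𝓝 (0 : Fin 3 → ℂ) := by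
  refine Filter.mem_of_superset (Metric.ball_mem_nhds 0 (show (0 : ℝ) < 1 / 3 by norm_num)) ?_
  intro x hx z w hz hw h
  have hi : ∀ i, ‖x i‖ < 1 / 3 := fun i => (norm_le_pi_norm x i).trans_lt (by simpa using hx)
  have h1 : (1 : ℂ) = x 0 * z + x 1 * w - x 2 * (z * w) := by linear_combination h
  have h2 : ‖(1 : ℂ)‖ ≤ ‖x 0‖ * ‖z‖ + ‖x 1‖ * ‖w‖ + ‖x 2‖ * (‖z‖ * ‖w‖) := by
    rw [h1]
    refine (norm_sub_le _ _).trans ?_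
    rw [norm_mul (x 2), norm_mul z]
    refine add_le_add_left ((norm_add_le _ _).trans ?_) _
    rw [norm_mul, norm_mul]
  rw [norm_one] at h2
  have a0 := mul_le_of_le_one_right (norm_nonneg (x 0)) hz
  have a1 := mul_le_of_le_one_right (norm_nonneg (x 1)) hw
  have a2 := mul_le_of_le_one_right (norm_nonneg (x 2)) (mul_le_one₀ hz (norm_nonneg w) hw)
  linarith [hi 0, hi 1, hi 2]

theorem exists_eq_second_order {f : ℂ → Fin 3 → ℂ} {a : Fin 3 → ℂ}
    (hd : DifferentiableOn ℂ f (Metric.ball 0 1)) (h0 : f 0 = 0) (ha : HasDerivAt f a 0) :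
    ∃ B : ℂ → Fin 3 → ℂ, ContinuousAt B 0 ∧ ∀ z, f z = z • a + z ^ 2 • B z := by
  have hn : Metric.ball (0 : ℂ) 1 ∈ 𝓝 0 := Metric.ball_mem_nhds 0 one_pos
  have hd1 : DifferentiableOn ℂ (dslope f 0) (Metric.ball 0 1) :=
    (Complex.differentiableOn_dslope hn).mpr hd
  refine ⟨dslope (dslope f 0) 0, continuousAt_dslope_same.mpr (hd1.differentiableAt hn),
    fun z => ?_⟩
  have e1 := sub_smul_dslope f 0 z
  have e2 := sub_smul_dslope (dslope f 0) 0 z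
  rw [dslope_same, ha.deriv] at e2
  simp only [sub_zero, h0] at e1 e2
  rw [pow_two, mul_smul, e2, smul_sub, e1]
  abel

/-! ### The tetrablock has no symmetry at the origin -/

/-- The tetrablock has no holomorphic self-map fixing the origin with derivative `-1` there. -/
theorem tetrablock_no_symmetry {S : (Fin 3 → ℂ) → Fin 3 → ℂ} (hS : AnalyticAt ℂ S 0)
    (hd : DifferentiableOn ℂ S tetrablock) (hm : MapsTo S tetrablock tetrablock) (h0 : S 0 = 0)
    (h' : HasFDerivAt S (-ContinuousLinearMap.id ℂ (Fin 3 → ℂ)) 0) : False := by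
  obtain ⟨Q, hQ⟩ := ((ContinuousLinearMap.proj (R := ℂ) (φ := fun _ : Fin 3 => ℂ)
    0).analyticAt _ |>.comp hS).exists_tendsto_second_order
    ((ContinuousLinearMap.proj (R := ℂ) (φ := fun _ : Fin 3 => ℂ) 0).hasFDerivAt.comp 0 h')
  have hball : ∀ z ∈ Metric.ball (0 : ℂ) 1, -z ∈ Metric.ball (0 : ℂ) 1 := by simp
  have key : ∀ y : ℂ, ‖y‖ = 1 → Q (fun _ => tetrablockDisc y 0) = -y / 2 := by
    intro y hy
    have hy0 : y ≠ 0 := by rintro rfl; simp at hy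
    have hyi : ‖y⁻¹‖ = 1 := by simp [hy]
    let d : ℂ → Fin 3 → ℂ := fun z => z • tetrablockDisc y z
    have hed : DifferentiableOn ℂ (tetrablockDisc y) (Metric.ball 0 1) := by
      rw [differentiableOn_pi]
      have h2 : ∀ z ∈ Metric.ball (0 : ℂ) 1, 2 + z ≠ 0 :=
        fun z hz => two_add_ne_zero (by simpa using hz)
      intro i
      fin_cases i <;> simp only [tetrablockDisc, Fin.mk_zero, Fin.mk_one, Fin.reduceFinMk,
        Matrix.cons_val_zero, Matrix.cons_val_one, Matrix.cons_val] <;>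
        exact DifferentiableOn.div (by fun_prop) (by fun_prop) h2
    have hec : ContinuousAt (tetrablockDisc y) 0 :=
      (hed.differentiableAt (Metric.ball_mem_nhds 0 one_pos)).continuousAt
    have hdd : DifferentiableOn ℂ d (Metric.ball 0 1) := differentiableOn_id.smul hed
    have hdm : MapsTo d (Metric.ball 0 1) tetrablock :=
      fun z hz => smul_tetrablockDisc_mem hy (by simpa using hz)
    have hdder : HasDerivAt d (tetrablockDisc y 0) 0 := by
      have := (hasDerivAt_id (0 : ℂ)).smul
        (hed.differentiableAt (Metric.ball_mem_nhds 0 one_pos)).hasDerivAt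
      refine this.congr_deriv ?_
      simp
    have hd0 : d 0 = 0 := by simp [d]
    -- `R` undoes the rotation by `y`, and the argument `-z` undoes the sign of `S'(0)`, so `f`
    -- leaves the origin in the direction `(1/2, 1/2, 1/2)`.
    let R : (Fin 3 → ℂ) →L[ℂ] (Fin 3 → ℂ) := ContinuousLinearMap.pi
      ![y⁻¹ • ContinuousLinearMap.proj 0, y⁻¹ • ContinuousLinearMap.proj 1,
        y⁻¹ ^ 2 • ContinuousLinearMap.proj 2]
    have hR : ∀ x, R x = ![y⁻¹ * x 0, y⁻¹ * x 1, y⁻¹ ^ 2 * x 2] := by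
      intro x; ext i; fin_cases i <;> simp [R]
    let f : ℂ → Fin 3 → ℂ := fun z => R (S (d (-z)))
    have hfd : DifferentiableOn ℂ f (Metric.ball 0 1) :=
      R.differentiable.comp_differentiableOn
        (hd.comp (hdd.comp (differentiableOn_neg _) hball) fun z hz => hdm (hball z hz))
    have hfm : MapsTo f (Metric.ball 0 1) tetrablock := by
      intro z hz
      simp only [f, hR]
      exact tetrablock_rotate_mem (hm (hdm (hball z hz))) hyi
    have hf0 : f 0 = 0 := by simp [f, hd0, h0]
    have hfder : HasDerivAt f (fun _ => 1 / 2) 0 := by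
      have h1 : HasDerivAt (fun z => d (-z)) (-tetrablockDisc y 0) 0 := by
        have := HasDerivAt.scomp (0 : ℂ) (g₁ := d) (h := fun z => -z)
          (g₁' := tetrablockDisc y 0) (by rwa [neg_zero]) (hasDerivAt_neg (0 : ℂ))
        exact this.congr_deriv (by simp)
      have h2 : HasFDerivAt S (-ContinuousLinearMap.id ℂ (Fin 3 → ℂ)) (d (-0)) := by
        simpa [hd0] using h'
      refine (R.hasFDerivAt.comp_hasDerivAt 0 (h2.comp_hasDerivAt 0 h1)).congr_deriv ?_
      rw [hR]
      ext i
      fin_cases i <;> simp [tetrablockDisc] <;> field_simp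
    obtain ⟨B, hBc, hB⟩ := exists_eq_second_order hfd hf0 hfder
    have hB0 : B 0 0 = -1 / 4 := by
      refine tetrablock_disc_second_coeff hfd hfm hBc fun z _ i => ?_
      rw [hB z]
      simp [mul_comm]
    refine tendsto_nhds_unique (hQ _ hec) ?_
    -- The same second-order quotient computed from `f`: the term `-y/(2(2 + z))` is `(-y/2 + y/(2 +
    -- z))/z`, the discrepancy between the linear parts. At `z = 0` both terms equal `-y/4`.
    have hlim : Tendsto (fun z : ℂ => y * B (-z) 0 - y / (2 * (2 + z))) (𝓝[≠] 0)
        (𝓝 (y * B (-0) 0 - y / (2 * (2 + 0)))) := by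
      have hB1 : ContinuousAt (fun z : ℂ => B (-z) 0) 0 := by
        have h1 : ContinuousAt (fun z => B z 0) (-0) := by
          simpa using continuousAt_pi.mp hBc 0
        exact h1.comp (f := fun z : ℂ => -z) continuousAt_neg
      have : ContinuousAt (fun z : ℂ => y * B (-z) 0 - y / (2 * (2 + z))) 0 := by
        refine (hB1.const_mul y).sub (ContinuousAt.div (by fun_prop) (by fun_prop) (by norm_num))
      exact this.tendsto.mono_left nhdsWithin_le_nhds
    have heq : y * B (-0) 0 - y / (2 * (2 + 0)) = -y / 2 := by
      rw [neg_zero, hB0]; ring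
    rw [heq] at hlim
    refine hlim.congr' ?_
    filter_upwards [self_mem_nhdsWithin,
      nhdsWithin_le_nhds (Metric.ball_mem_nhds (0 : ℂ) one_pos)] with z hz hz1
    have hz : z ≠ 0 := hz
    have h2 := two_add_ne_zero (l := z) (by simpa using hz1)
    have h3 : S (z • tetrablockDisc y z) 0 = y * (-z * (1 / 2) + z ^ 2 * B (-z) 0) := by
      have := congrFun (hB (-z)) 0
      simp only [f, hR, neg_neg, d, Matrix.cons_val_zero, Pi.add_apply, Pi.smul_apply,
        smul_eq_mul] at this
      field_simp at this ⊢
      linear_combination this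
    simp only [Function.comp_apply, ContinuousLinearMap.proj_apply, h3, h0, Pi.zero_apply,
      ContinuousLinearMap.comp_apply, neg_apply, ContinuousLinearMap.id_apply,
      Pi.neg_apply]
    simp only [tetrablockDisc, Matrix.cons_val_zero]
    field_simp
    ring
  set v : Fin 3 → ℂ := ![1, 1, 0]
  set u : Fin 3 → ℂ := ![0, 0, 1]
  have hexp : ∀ y : ℂ, Q (fun _ => v + y • u)
      = Q ![v, v] + y * (Q ![v, u] + Q ![u, v]) + y ^ 2 * Q ![u, u] := by
    intro y
    have hfun : (fun _ : Fin 2 => v + y • u) = ![v + y • u, v + y • u] := by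
      ext i; fin_cases i <;> rfl
    have l0 : ∀ a b c : Fin 3 → ℂ, Q ![a + y • b, c] = Q ![a, c] + y * Q ![b, c] := by
      intro a b c
      have := Q.cons_add ![c] a (y • b)
      rw [Q.cons_smul ![c] y b] at this
      simpa using this
    have l1 : ∀ a b c : Fin 3 → ℂ, Q ![c, a + y • b] = Q ![c, a] + y * Q ![c, b] := by
      intro a b c
      have e : ∀ t s : Fin 3 → ℂ, Function.update ![c, s] 1 t = ![c, t] := by
        intro t s; ext i; fin_cases i <;> simp
      have := Q.map_update_add ![c, 0] 1 a (y • b)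
      rw [Q.map_update_smul ![c, 0] 1 y b, e, e, e] at this
      simpa using this
    rw [hfun, l0, l1, l1]
    ring
  have hval : ∀ y : ℂ, ‖y‖ = 1 → y * Q (fun _ => v + y • u) = -2 := by
    intro y hy
    have hy0 : y ≠ 0 := by rintro rfl; simp at hy
    have h1 : tetrablockDisc y 0 = (y / 2) • (v + y • u) := by
      ext i; fin_cases i <;> simp [tetrablockDisc, v, u]; ring
    have h2 := key y hy
    rw [h1, Q.map_smul_univ (fun _ => y / 2) (fun _ => v + y • u)] at h2
    simp only [Finset.prod_const, Finset.card_univ, Fintype.card_fin, smul_eq_mul] at h2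
    apply mul_left_cancel₀ hy0
    linear_combination 4 * h2
  simp only [hexp] at hval
  have e1 := hval 1 (by simp)
  have e2 := hval (-1) (by simp)
  have e3 := hval Complex.I (by simp)
  have e4 := hval (-Complex.I) (by simp)
  have hI := Complex.I_sq
  -- Summing over the fourth roots of unity annihilates `y`, `y²` and `y³`, while the right sides
  -- add up to `-8`.
  have : (8 : ℂ) = 0 := by
    linear_combination e1 + e2 + e3 + e4 - 2 * (Q ![v, u] + Q ![u, v]) * hI
  norm_num at this

/-! ### Retracts of domains with point symmetries -/

theorem tetrablock_not_retract_of_symmetric {W : Type*} [NormedAddCommGroup W] [NormedSpace ℂ W]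
    {Ω : Set W} (hΩ : ∀ w ∈ Ω, ∃ s : W → W, DifferentiableOn ℂ s Ω ∧ MapsTo s Ω Ω ∧
      AnalyticAt ℂ s w ∧ s w = w ∧ HasFDerivAt s (-ContinuousLinearMap.id ℂ W) w) :
    ¬ IsAnalyticRetract tetrablock Ω := by
  rintro ⟨h, κ, hh, hhm, hκ, hκm, hid⟩
  have h0 := zero_mem_tetrablock
  have hw := hhm h0
  obtain ⟨s, hsd, hsm, hsa, hsw, hs'⟩ := hΩ _ hw
  have hκ0 : κ (h 0) = 0 := hid 0 h0
  refine tetrablock_no_symmetry (S := fun x => κ (s (h x))) ?_ ?_ ?_ ?_ ?_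
  · refine AnalyticAt.fun_comp (g := κ) (f := fun x => s (h x)) ?_ (AnalyticAt.fun_comp hsa (hh 0 h0))
    simp only [hsw]
    exact hκ _ hw
  · exact hκ.differentiableOn.comp (hsd.comp hh.differentiableOn hhm) fun x hx => hsm (hhm hx)
  · exact fun x hx => hκm (hsm (hhm hx))
  · simp only [hsw, hκ0]
  · have hh' := (hh 0 h0).differentiableAt.hasFDerivAt
    have hκ' := (hκ _ hw).differentiableAt.hasFDerivAt
    have hcomp : (fderiv ℂ κ (h 0)).comp (fderiv ℂ h 0) = ContinuousLinearMap.id ℂ _ := by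
      have h1 := hκ'.comp (0 : Fin 3 → ℂ) hh'
      have h2 : HasFDerivAt (κ ∘ h) (ContinuousLinearMap.id ℂ (Fin 3 → ℂ)) 0 := by
        refine (hasFDerivAt_id 0).congr_of_eventuallyEq ?_
        filter_upwards [tetrablock_mem_nhds_zero] with x hx using hid x hx
      exact h1.unique h2
    have h1 := hs'.comp (0 : Fin 3 → ℂ) hh'
    have h2 : HasFDerivAt κ (fderiv ℂ κ (h 0)) ((s ∘ h) 0) := by
      rw [Function.comp_apply, hsw]; exact hκ'
    refine (h2.comp (0 : Fin 3 → ℂ) h1).congr_fderiv ?_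
    rw [← hcomp]
    ext1 x
    simp

/-- An involution has derivative `-1` at an isolated fixed point. -/
theorem fderiv_eq_neg_id_of_isolated_fixedPoint {V : Type*} [NormedAddCommGroup V]
    [NormedSpace ℂ V] [CompleteSpace V] {s : V → V} {z : V} (hs : AnalyticAt ℂ s z)
    (hss : ∀ᶠ x in 𝓝 z, s (s x) = x) (hz : s z = z) (hiso : ∀ᶠ x in 𝓝[≠] z, s x ≠ x) :
    fderiv ℂ s z = -ContinuousLinearMap.id ℂ V := by
  set L := fderiv ℂ s z with hL
  have hsL : HasStrictFDerivAt s L z := hs.hasStrictFDerivAt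
  have hLL : L.comp L = ContinuousLinearMap.id ℂ V := by
    have h1 : HasFDerivAt s L (s z) := by rw [hz]; exact hsL.hasFDerivAt
    have h2 := h1.comp z hsL.hasFDerivAt
    exact h2.unique ((hasFDerivAt_id z).congr_of_eventuallyEq hss)
  have hLLx : ∀ x, L (L x) = x := fun x => congrArg (fun T : V →L[ℂ] V => T x) hLL
  let e : V ≃L[ℂ] V := ContinuousLinearEquiv.smulLeft (Units.mk0 (2 : ℂ) two_ne_zero)
  -- Since `L² = 1`, `φ ∘ s = L ∘ φ` near `z`, and `φ'(z) = 1 + L² = 2` is invertible: `φ`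
  -- linearizes `s`. A vector `v ≠ 0` with `Lv = v` would give the fixed points `φ⁻¹(tv)` of `s`,
  -- which accumulate at `z`.
  let φ : V → V := fun x => (x - z) + L (s x - z)
  have hφ : HasStrictFDerivAt φ (e : V →L[ℂ] V) z := by
    have h1 := ((hasStrictFDerivAt_id z).sub_const z).add
      (L.hasStrictFDerivAt.comp z (hsL.sub_const z))
    refine h1.congr_fderiv ?_
    rw [hLL]
    ext x
    simp [e, two_smul]
  have hφz : φ z = 0 := by simp [φ, hz]
  have hfix : ∀ v, L v = v → v = 0 := by
    intro v hv
    by_contra hv0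
    set g := hφ.localInverse with hg
    have hg0 : Tendsto g (𝓝 0) (𝓝 z) := by
      have := hφ.localInverse_tendsto
      rwa [hφz] at this
    have hright : ∀ᶠ y in 𝓝 0, φ (g y) = y := by
      have := hφ.eventually_right_inverse
      rwa [hφz] at this
    have hleft : ∀ᶠ x in 𝓝 z, g (φ x) = x := hφ.eventually_left_inverse
    have hsz : Tendsto s (𝓝 z) (𝓝 z) := by
      have := hs.continuousAt.tendsto
      rwa [hz] at this
    have hall : ∀ᶠ y in 𝓝 (0 : V), φ (g y) = y ∧ s (s (g y)) = g y ∧ g (φ (s (g y))) = s (g y) ∧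
        (g y ≠ z → s (g y) ≠ g y) := by
      filter_upwards [hright, hg0.eventually hss, hg0.eventually (hsz.eventually hleft),
        hg0.eventually (eventually_nhdsWithin_iff.mp hiso)] with y h1 h2 h3 h4
      exact ⟨h1, h2, h3, h4⟩
    have hline : Tendsto (fun t : ℂ => t • v) (𝓝[≠] 0) (𝓝 0) := by
      have : ContinuousAt (fun t : ℂ => t • v) 0 := by fun_prop
      simpa using this.tendsto.mono_left nhdsWithin_le_nhds
    obtain ⟨t, ⟨h1, h2, h3, h4⟩, ht⟩ := ((hline.eventually hall).and self_mem_nhdsWithin).exists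
    have ht : t ≠ 0 := ht
    have hφs : φ (s (g (t • v))) = t • v := by
      calc φ (s (g (t • v))) = L (φ (g (t • v))) := by
            simp only [φ, h2, map_add, hLLx]; abel
        _ = t • v := by rw [h1, map_smul, hv]
    rw [hφs] at h3
    refine h4 (fun h => ?_) h3.symm
    rw [h, hφz] at h1
    exact smul_ne_zero ht hv0 h1.symm
  ext x
  -- `Lx + x` is fixed by `L`, hence zero.
  have := hfix (L x + x) (by rw [map_add, hLLx, add_comm])
  simpa using eq_neg_of_add_eq_zero_left this

theorem IsBoundedSymmetricDomain.tetrablock_not_retract {V : Type*} [NormedAddCommGroup V]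
    [NormedSpace ℂ V] [CompleteSpace V] {Ω : Set V} (hΩ : IsBoundedSymmetricDomain Ω) :
    ¬ IsAnalyticRetract tetrablock Ω := by
  refine tetrablock_not_retract_of_symmetric fun w hw => ?_
  obtain ⟨s, hs, hm, hss, hsw, hiso⟩ := hΩ.symmetric w hw
  refine ⟨s, hs.differentiableOn, hm, hs w hw, hsw, ?_⟩
  rw [← fderiv_eq_neg_id_of_isolated_fixedPoint (hs w hw)
    (by filter_upwards [hΩ.isOpen.mem_nhds hw] with x hx using hss x hx) hsw hiso]
  exact (hs w hw).differentiableAt.hasFDerivAt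

/-! ### Point symmetries of the unit ball of operators -/

section JStar

variable {H K : Type*} [NormedAddCommGroup H] [InnerProductSpace ℂ H] [CompleteSpace H]
  [NormedAddCommGroup K] [InnerProductSpace ℂ K] [CompleteSpace K]

open ContinuousLinearMap (adjoint)

/-- The denominator of the symmetry of the unit ball of operators about `W`. -/
noncomputable def symmDenom (W Z : H →L[ℂ] K) : H →L[ℂ] H :=
  1 + (adjoint W).comp W - (2 : ℂ) • (adjoint W).comp Z

/-- The symmetry about `W` of the open unit ball of operators. -/
noncomputable def ballSymm (W Z : H →L[ℂ] K) : H →L[ℂ] K :=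
  W - (Z - W).comp (Ring.inverse (symmDenom W Z) * (1 - (adjoint W).comp W))

/-- The real part of `⟨Dx, x⟩` is `‖x‖² + ‖Wx‖² - 2 Re⟨Zx, Wx⟩ ≥ (1 - ‖Z‖)‖x‖²`, so `D` is coercive.
-/
theorem isUnit_symmDenom (W : H →L[ℂ] K) {Z : H →L[ℂ] K} (hZ : ‖Z‖ < 1) :
    IsUnit (symmDenom W Z) := by
  have hc : 0 < 1 - ‖Z‖ := by linarith
  refine ContinuousLinearMap.isUnit_of_forall_le_norm_inner_map _ (c := ⟨1 - ‖Z‖, hc.le⟩) hc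
    fun x => ?_
  refine le_trans ?_ (Complex.re_le_norm _)
  have h1 : (inner ℂ (symmDenom W Z x) x : ℂ)
      = inner ℂ x x + inner ℂ (W x) (W x) - 2 * inner ℂ (Z x) (W x) := by
    simp [symmDenom, ContinuousLinearMap.adjoint_inner_left]
    ring
  have h3 : ((inner ℂ (Z x) (W x) : ℂ)).re ≤ ‖Z x‖ * ‖W x‖ := re_inner_le_norm (𝕜 := ℂ) _ _
  rw [h1, inner_self_eq_norm_sq_to_K, inner_self_eq_norm_sq_to_K]
  have h4 : ((‖x‖ : ℂ) ^ 2 + (‖W x‖ : ℂ) ^ 2 - 2 * inner ℂ (Z x) (W x) : ℂ).re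
      = ‖x‖ ^ 2 + ‖W x‖ ^ 2 - 2 * (inner ℂ (Z x) (W x) : ℂ).re := by
    simp [← Complex.ofReal_pow]
  refine le_trans ?_ h4.ge
  change ‖x‖ ^ 2 * (1 - ‖Z‖) ≤ _
  have h5 := Z.le_opNorm x
  have h6 : ‖Z x‖ * ‖W x‖ ≤ ‖Z‖ * ‖x‖ * ‖W x‖ := mul_le_mul_of_nonneg_right h5 (norm_nonneg _)
  nlinarith [mul_nonneg (norm_nonneg Z) (sq_nonneg (‖x‖ - ‖W x‖)),
    mul_nonneg hc.le (sq_nonneg ‖W x‖)]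

theorem isUnit_one_sub_adjoint_comp {W : H →L[ℂ] K} (hW : ‖W‖ < 1) :
    IsUnit (1 - (adjoint W).comp W) := by
  have := isUnit_symmDenom W hW
  rwa [symmDenom, two_smul, add_sub_add_right_eq_sub] at this

theorem ballSymm_self (W : H →L[ℂ] K) : ballSymm W W = W := by simp [ballSymm]

/-- With `x = D⁻¹(1 - W*W)y`, the identity `‖y‖² - ‖x‖² = ‖s y‖² - ‖Zx‖²` gives `‖s y‖² ≤ ‖y‖² - (1
- ‖Z‖²)‖x‖²`. The bound `‖x‖ ≥ (c/4)‖y‖` makes the gain uniform in `y`; this is the origin of `δ`.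
-/
theorem norm_ballSymm_lt_one {W Z : H →L[ℂ] K} (hW : ‖W‖ < 1) (hZ : ‖Z‖ < 1) :
    ‖ballSymm W Z‖ < 1 := by
  have hu := isUnit_symmDenom W hZ
  set c : ℝ := 1 - ‖W‖ ^ 2
  have hc : 0 < c := by simp only [c]; nlinarith [norm_nonneg W]
  have hc1 : c ≤ 1 := by simp only [c]; nlinarith [norm_nonneg W]
  set δ : ℝ := (1 - ‖Z‖ ^ 2) * (c / 4) ^ 2 with hδ
  have hZ2 : 0 < 1 - ‖Z‖ ^ 2 := by nlinarith [norm_nonneg Z]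
  have hδ0 : 0 < δ := by positivity
  have hδ1 : δ ≤ 1 := by
    have h1 : (c / 4) ^ 2 ≤ 1 := by nlinarith
    have h2 : 1 - ‖Z‖ ^ 2 ≤ 1 := by nlinarith [sq_nonneg ‖Z‖]
    exact mul_le_one₀ h2 (by positivity) h1
  have key : ∀ y, ‖ballSymm W Z y‖ ≤ √(1 - δ) * ‖y‖ := by
    intro y
    set x := Ring.inverse (symmDenom W Z) ((1 - (adjoint W).comp W) y) with hx
    have hxy : symmDenom W Z x = (1 - (adjoint W).comp W) y := by
      rw [hx, ← mul_apply_eq_comp, Ring.mul_inverse_cancel _ hu]; rfl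
    have hs : ballSymm W Z y = W (y + x) - Z x := by
      change W y - (Z x - W x) = _
      rw [map_add]; abel
    have hyx : y - x = adjoint W (W (y + x) - (2 : ℂ) • Z x) := by
      simp only [symmDenom, sub_apply, add_apply, smul_apply,
        one_apply_eq_self, ContinuousLinearMap.comp_apply] at hxy
      simp only [map_add, map_sub, map_smul]
      rw [eq_sub_iff_add_eq] at hxy
      rw [sub_eq_iff_eq_add]
      exact hxy.symm.trans (by abel)
    have e1 : ‖y‖ ^ 2 - ‖x‖ ^ 2 = ((inner ℂ (y - x) (y + x) : ℂ)).re := by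
      rw [inner_sub_left, inner_add_right, inner_add_right]
      have h1 := inner_re_symm (𝕜 := ℂ) x y
      have h2 := inner_self_eq_norm_sq (𝕜 := ℂ) x
      have h3 := inner_self_eq_norm_sq (𝕜 := ℂ) y
      simp only [RCLike.re_to_complex] at h1 h2 h3
      simp only [Complex.add_re, Complex.sub_re]
      linarith
    have e2 : ‖y‖ ^ 2 - ‖x‖ ^ 2 = ‖ballSymm W Z y‖ ^ 2 - ‖Z x‖ ^ 2 := by
      rw [e1, hyx, ContinuousLinearMap.adjoint_inner_left, hs, inner_sub_left, inner_smul_left,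
        norm_sub_sq (𝕜 := ℂ)]
      have h2 := inner_self_eq_norm_sq (𝕜 := ℂ) (W (y + x))
      have h3 := inner_re_symm (𝕜 := ℂ) (W (y + x)) (Z x)
      simp only [RCLike.re_to_complex] at h2 h3 ⊢
      rw [Complex.sub_re, h2, h3]
      simp
    have hZx := Z.le_opNorm x
    have hyx' : c * ‖y‖ ≤ 4 * ‖x‖ := by
      have h1 : ‖y‖ ≤ ‖x‖ + ‖y - x‖ := by
        have := norm_add_le x (y - x)
        simpa using this
      have h2 : ‖y - x‖ ≤ ‖W‖ * (‖W‖ * (‖y‖ + ‖x‖) + 2 * ‖x‖) := by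
        rw [hyx]
        refine ((adjoint W).le_opNorm _).trans ?_
        rw [LinearIsometryEquiv.norm_map]
        refine mul_le_mul_of_nonneg_left ((norm_sub_le _ _).trans ?_) (norm_nonneg _)
        refine add_le_add ?_ ?_
        · exact (W.le_opNorm _).trans
            (mul_le_mul_of_nonneg_left (norm_add_le _ _) (norm_nonneg _))
        · rw [norm_smul]
          have : ‖Z x‖ ≤ ‖x‖ := hZx.trans (mul_le_of_le_one_left (norm_nonneg _) hZ.le)
          simpa using this
      have h3 := norm_nonneg W
      have h4 := norm_nonneg x
      have h5 : ‖W‖ * ‖x‖ ≤ ‖x‖ := mul_le_of_le_one_left h4 hW.le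
      have h6 : ‖W‖ * (‖W‖ * ‖x‖) ≤ ‖x‖ := (mul_le_of_le_one_left (by positivity) hW.le).trans h5
      simp only [c]
      nlinarith
    have e3 : ‖Z x‖ ^ 2 ≤ ‖Z‖ ^ 2 * ‖x‖ ^ 2 := by
      rw [← mul_pow]; exact pow_le_pow_left₀ (norm_nonneg _) hZx 2
    have e4 : (c / 4) ^ 2 * ‖y‖ ^ 2 ≤ ‖x‖ ^ 2 := by
      rw [← mul_pow]
      exact pow_le_pow_left₀ (by positivity) (by linarith) 2
    have e5 := mul_le_mul_of_nonneg_left e4 hZ2.le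
    apply le_of_sq_le_sq _ (by positivity)
    rw [mul_pow, Real.sq_sqrt (by linarith), hδ]
    nlinarith
  refine (ContinuousLinearMap.opNorm_le_bound _ (by positivity) key).trans_lt ?_
  rw [Real.sqrt_lt' one_pos]
  linarith

theorem analyticAt_ballSymm_aux (W : H →L[ℂ] K) {Z : H →L[ℂ] K} (hZ : ‖Z‖ < 1) :
    AnalyticAt ℂ (fun Z => Ring.inverse (symmDenom W Z) * (1 - (adjoint W).comp W)) Z := by
  obtain ⟨u, hu⟩ := isUnit_symmDenom W hZ
  have h1 : AnalyticAt ℂ (symmDenom W) Z := by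
    have : symmDenom W = fun Z => 1 + (adjoint W).comp W
        - ((2 : ℂ) • ContinuousLinearMap.compL ℂ H K H (adjoint W)) Z := rfl
    rw [this]
    exact analyticAt_const.sub (ContinuousLinearMap.analyticAt _ _)
  have h2 : AnalyticAt ℂ (Ring.inverse : (H →L[ℂ] H) → _) (symmDenom W Z) := by
    rw [← hu]; exact analyticAt_inverse u
  exact (h2.fun_comp h1).mul analyticAt_const

theorem analyticAt_ballSymm (W : H →L[ℂ] K) {Z : H →L[ℂ] K} (hZ : ‖Z‖ < 1) :
    AnalyticAt ℂ (ballSymm W) Z := by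
  refine analyticAt_const.sub ?_
  exact AnalyticAt.comp₂ ((ContinuousLinearMap.compL ℂ H H K).analyticAt_bilinear _)
    (analyticAt_id.sub analyticAt_const) (analyticAt_ballSymm_aux W hZ)

theorem hasFDerivAt_ballSymm {W : H →L[ℂ] K} (hW : ‖W‖ < 1) :
    HasFDerivAt (ballSymm W) (-ContinuousLinearMap.id ℂ (H →L[ℂ] K)) W := by
  have h1 : Ring.inverse (symmDenom W W) * (1 - (adjoint W).comp W) = 1 := by
    have : symmDenom W W = 1 - (adjoint W).comp W := by
      rw [symmDenom, two_smul, add_sub_add_right_eq_sub]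
    rw [this, Ring.inverse_mul_cancel _ (isUnit_one_sub_adjoint_comp hW)]
  have h2 := (((hasFDerivAt_id W).sub_const W).clm_comp
    (analyticAt_ballSymm_aux W hW).differentiableAt.hasFDerivAt).const_sub W
  refine h2.congr_fderiv ?_
  ext1 Y
  simp [h1]
  rfl

/-! ### The symmetries preserve J*-algebras -/

variable {A : Submodule ℂ (H →L[ℂ] K)}

/-- Polarization: averaging `c (T + cS)(T + cS)*(T + cS)` over the fourth roots of unity `c` leaves
only the term with coefficient `c̄`, namely `T S* T`. -/
theorem IsJStarAlgebra.comp_adjoint_comp_mem (hA : IsJStarAlgebra A) {T S : H →L[ℂ] K}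
    (hT : T ∈ A) (hS : S ∈ A) : T.comp ((adjoint S).comp T) ∈ A := by
  have hc : ∀ c : ℂ, (T + c • S).comp ((adjoint (T + c • S)).comp (T + c • S)) ∈ A :=
    fun c => hA.triple_mem _ (A.add_mem hT (A.smul_mem c hS))
  have hsum := A.smul_mem (1 / 4) (A.add_mem (A.sub_mem (hc 1) (hc (-1)))
    (A.smul_mem Complex.I (A.sub_mem (hc Complex.I) (hc (-Complex.I)))))
  convert hsum using 1
  ext x
  simp only [ContinuousLinearMap.comp_apply, smul_apply, add_apply, sub_apply, map_add, map_smul,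
    map_smulₛₗ, smul_add, smul_smul, smul_sub, Complex.conj_I, map_neg, map_one]
  match_scalars <;> ring_nf <;> simp [Complex.I_sq]
  all_goals norm_num

theorem norm_comp_adjoint_comp_le (P y Q : H →L[ℂ] K) :
    ‖P.comp ((adjoint y).comp Q)‖ ≤ ‖P‖ * (‖y‖ * ‖Q‖) := by
  refine (P.opNorm_comp_le _).trans (mul_le_mul_of_nonneg_left ?_ (norm_nonneg _))
  have := (adjoint y).opNorm_comp_le Q
  rwa [LinearIsometryEquiv.norm_map] at this

theorem isUnit_one_sub_adjoint_comp_of_mul_lt {y Y : H →L[ℂ] K} (h : ‖y‖ * ‖Y‖ < 1) :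
    IsUnit (1 - (adjoint y).comp Y) := by
  apply isUnit_one_sub_of_norm_lt_one
  refine ((adjoint y).opNorm_comp_le Y).trans_lt ?_
  rwa [LinearIsometryEquiv.norm_map]

/-- The map `X ↦ X - (Y y* X + X y* Y) / 2` is injective if `‖y‖ * ‖Y‖ < 1`, and it maps the
quasi-inverse `Y (1 - y* Y)⁻¹` to `Y`. -/
theorem comp_one_sub_adjoint_comp_eq {y Y X : H →L[ℂ] K} (h : ‖y‖ * ‖Y‖ < 1)
    (hX : X - (1 / 2 : ℂ) • (Y.comp ((adjoint y).comp X) + X.comp ((adjoint y).comp Y)) = Y) :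
    X.comp (1 - (adjoint y).comp Y) = Y := by
  have hv := isUnit_one_sub_adjoint_comp_of_mul_lt h
  set N := (adjoint y).comp Y with hN
  set X' : H →L[ℂ] K := Y.comp (Ring.inverse (1 - N)) with hX'
  have h2 : X' - X'.comp N = Y := by
    have : X'.comp (1 - N) = Y := by
      rw [hX', ContinuousLinearMap.comp_assoc]
      exact (congrArg _ (Ring.inverse_mul_cancel _ hv)).trans (ContinuousLinearMap.comp_id _)
    rw [ContinuousLinearMap.comp_sub] at this
    exact this
  have h3 : X' - Y.comp ((adjoint y).comp X') = Y := by
    have h4 : (1 - N) * Ring.inverse (1 - N) = 1 := Ring.mul_inverse_cancel _ hv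
    have h5 : Y.comp ((1 - N) * Ring.inverse (1 - N)) = Y := by
      rw [h4]; exact ContinuousLinearMap.comp_id _
    rw [sub_mul, one_mul, ContinuousLinearMap.comp_sub] at h5
    exact h5
  -- The quasi-inverse `X'` solves both one-sided equations, hence the symmetrized one. The
  -- difference `Δ` of two solutions satisfies `‖Δ‖ ≤ ‖y‖‖Y‖‖Δ‖`, so it vanishes.
  have hXX' : X = X' := by
    obtain ⟨Δ, hΔ⟩ : ∃ Δ, Δ = X - X' := ⟨_, rfl⟩
    have h6 : Δ = (1 / 2 : ℂ) • (Y.comp ((adjoint y).comp Δ) + Δ.comp N) := by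
      have e1 : (adjoint y).comp Δ = (adjoint y).comp X - (adjoint y).comp X' := by
        rw [hΔ, ContinuousLinearMap.comp_sub]
      have e2 : Δ.comp N = X.comp N - X'.comp N := by
        rw [hΔ, ContinuousLinearMap.sub_comp]
      rw [e1, e2, ContinuousLinearMap.comp_sub, hΔ]
      generalize Y.comp ((adjoint y).comp X') = a at *
      generalize Y.comp ((adjoint y).comp X) = b at *
      generalize X'.comp N = c at *
      generalize X.comp N = d at *
      have hca : c = a := by rw [← h3] at h2; exact sub_right_injective h2
      have hXe := sub_eq_iff_eq_add.mp hX
      have hXe' := sub_eq_iff_eq_add.mp h3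
      rw [hca, hXe, hXe']
      module
    have h7 : ‖Δ‖ ≤ ‖y‖ * ‖Y‖ * ‖Δ‖ := by
      have e1 := norm_comp_adjoint_comp_le Y y Δ
      have e2 := norm_comp_adjoint_comp_le Δ y Y
      have e3 := norm_add_le (Y.comp ((adjoint y).comp Δ)) (Δ.comp N)
      have e4 : ‖Δ‖ = 1 / 2 * ‖Y.comp ((adjoint y).comp Δ) + Δ.comp N‖ := by
        conv_lhs => rw [h6, norm_smul]
        norm_num
      nlinarith
    have h8 : ‖Δ‖ = 0 := by nlinarith [norm_nonneg Δ]
    exact sub_eq_zero.mp (hΔ ▸ norm_eq_zero.mp h8)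
  rw [hXX', ContinuousLinearMap.comp_sub]
  exact h2

/-- The relation between `y` and `W` factors the denominator as `(1 - W*W)(1 - y*(Z - W))`. The
symmetry thus becomes `W` minus the quasi-inverse of `Z - W`, which can be expressed by triple
products. -/
theorem ballSymm_eq_sub {W y Z X : H →L[ℂ] K} (hW : ‖W‖ < 1)
    (h : (1 - (adjoint W).comp W).comp (adjoint y) = (2 : ℂ) • adjoint W) (hZ : ‖Z‖ < 1)
    (hX : X.comp (1 - (adjoint y).comp (Z - W)) = Z - W) : ballSymm W Z = W - X := by
  have hu := isUnit_symmDenom W hZ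
  have hD : symmDenom W Z = (1 - (adjoint W).comp W) * (1 - (adjoint y).comp (Z - W)) := by
    rw [mul_sub, mul_one]
    have : (1 - (adjoint W).comp W) * ((adjoint y).comp (Z - W))
        = (2 : ℂ) • (adjoint W).comp (Z - W) := by
      change (1 - (adjoint W).comp W).comp ((adjoint y).comp (Z - W)) = _
      rw [← ContinuousLinearMap.comp_assoc, h, ContinuousLinearMap.smul_comp]
    rw [this, symmDenom, ContinuousLinearMap.comp_sub]
    module
  have hE : (1 - (adjoint y).comp (Z - W)) *
      (Ring.inverse (symmDenom W Z) * (1 - (adjoint W).comp W)) = 1 := by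
    apply (isUnit_one_sub_adjoint_comp hW).mul_left_cancel
    rw [← mul_assoc, ← mul_assoc, ← hD, Ring.mul_inverse_cancel _ hu, one_mul, mul_one]
  rw [ballSymm]
  congr 1
  have h1 := congrArg (X.comp ·) hE
  have h2 : X.comp 1 = X := ContinuousLinearMap.comp_id _
  simp only [h2] at h1
  rw [← h1]
  conv_lhs => rw [← hX]
  rfl

variable {E : Type*} [NormedAddCommGroup E] [NormedSpace ℂ E] {ι : E →ₗᵢ[ℂ] (H →L[ℂ] K)}

/-- The symmetrized triple product `(Y, X) ↦ (Y y* X + X y* Y) / 2`. -/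
theorem exists_symm_triple
    (hι : ∀ T S : E, ∃ X, ι X = (ι T).comp ((adjoint (ι S)).comp (ι T))) (y : E) :
    ∃ B : E →L[ℂ] E →L[ℂ] E, (∀ Y X, ι (B Y X) = (1 / 2 : ℂ) •
      ((ι Y).comp ((adjoint (ι y)).comp (ι X)) + (ι X).comp ((adjoint (ι y)).comp (ι Y)))) ∧
      ∀ Y, ‖B Y‖ ≤ ‖y‖ * ‖Y‖ := by
  have hex : ∀ Y X, ∃ V, ι V = (1 / 2 : ℂ) •
      ((ι Y).comp ((adjoint (ι y)).comp (ι X)) + (ι X).comp ((adjoint (ι y)).comp (ι Y))) := by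
    intro Y X
    obtain ⟨V₁, h₁⟩ := hι (Y + X) y
    obtain ⟨V₂, h₂⟩ := hι Y y
    obtain ⟨V₃, h₃⟩ := hι X y
    refine ⟨(1 / 2 : ℂ) • (V₁ - V₂ - V₃), ?_⟩
    rw [map_smul, map_sub, map_sub, h₁, h₂, h₃]
    congr 1
    ext x
    simp only [ContinuousLinearMap.comp_apply, add_apply, sub_apply, map_add]
    abel
  choose b hb using hex
  have hadd₁ : ∀ u v x, b (u + v) x = b u x + b v x := by
    intro u v x
    apply ι.injective
    ext
    simp only [hb, map_add, ContinuousLinearMap.comp_apply, add_apply, smul_apply]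
    module
  have hsmul₁ : ∀ (c : ℂ) u x, b (c • u) x = c • b u x := by
    intro c u x
    apply ι.injective
    ext
    simp only [hb, map_smul, ContinuousLinearMap.comp_apply, add_apply, smul_apply]
    module
  have hcomm : ∀ u x, b u x = b x u := fun u x => ι.injective (by rw [hb, hb, add_comm])
  let B₀ : E →ₗ[ℂ] E →ₗ[ℂ] E := LinearMap.mk₂ ℂ b hadd₁ hsmul₁
    (fun u v x => by rw [hcomm, hadd₁, hcomm v, hcomm x])
    (fun c u v => by rw [hcomm, hsmul₁, hcomm v])
  have hB₀ : ∀ Y X, ‖B₀ Y X‖ ≤ ‖y‖ * ‖Y‖ * ‖X‖ := by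
    intro Y X
    change ‖b Y X‖ ≤ _
    rw [← ι.norm_map, hb, norm_smul]
    have h1 := norm_comp_adjoint_comp_le (ι Y) (ι y) (ι X)
    have h2 := norm_comp_adjoint_comp_le (ι X) (ι y) (ι Y)
    have h3 := norm_add_le ((ι Y).comp ((adjoint (ι y)).comp (ι X)))
      ((ι X).comp ((adjoint (ι y)).comp (ι Y)))
    simp only [ι.norm_map] at h1 h2
    norm_num
    nlinarith
  refine ⟨B₀.mkContinuous₂ ‖y‖ hB₀, hb, fun Y => ?_⟩
  exact ContinuousLinearMap.opNorm_le_bound _ (by positivity) (hB₀ Y)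

theorem comp_one_sub_eq_of_symm_triple [CompleteSpace E] {y : E} {B : E →L[ℂ] E →L[ℂ] E}
    (hB : ∀ Y X, ι (B Y X) = (1 / 2 : ℂ) •
      ((ι Y).comp ((adjoint (ι y)).comp (ι X)) + (ι X).comp ((adjoint (ι y)).comp (ι Y))))
    (hBn : ∀ Y, ‖B Y‖ ≤ ‖y‖ * ‖Y‖) {Y : E} (h : ‖y‖ * ‖Y‖ < 1) :
    (ι (Ring.inverse (1 - B Y) Y)).comp (1 - (adjoint (ι y)).comp (ι Y)) = ι Y := by
  have hu : IsUnit (1 - B Y) := isUnit_one_sub_of_norm_lt_one ((hBn Y).trans_lt h)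
  refine comp_one_sub_adjoint_comp_eq (by rwa [ι.norm_map, ι.norm_map]) ?_
  rw [← hB, ← map_sub]
  congr 1
  change (1 - B Y) (Ring.inverse (1 - B Y) Y) = Y
  rw [← mul_apply_eq_comp, Ring.mul_inverse_cancel _ hu]
  rfl

/-- The solution is `y = 2w(1 - w*w)⁻¹`, twice the quasi-inverse of `w` relative to itself; solving
the symmetrized equation inside `E` keeps it in `E`. -/
theorem exists_comp_adjoint_eq [CompleteSpace E]
    (hι : ∀ T S : E, ∃ X, ι X = (ι T).comp ((adjoint (ι S)).comp (ι T))) {w : E} (hw : ‖w‖ < 1) :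
    ∃ y, (1 - (adjoint (ι w)).comp (ι w)).comp (adjoint (ι y)) = (2 : ℂ) • adjoint (ι w) := by
  obtain ⟨B, hB, hBn⟩ := exists_symm_triple hι w
  have h := comp_one_sub_eq_of_symm_triple hB hBn (Y := w) (by nlinarith [norm_nonneg w])
  refine ⟨(2 : ℂ) • Ring.inverse (1 - B w) w, ?_⟩
  have h1 : adjoint (1 - (adjoint (ι w)).comp (ι w)) = 1 - (adjoint (ι w)).comp (ι w) := by
    rw [map_sub, ContinuousLinearMap.adjoint_comp, ContinuousLinearMap.adjoint_adjoint]
    congr 1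
    exact ContinuousLinearMap.adjoint_id
  have h2 := congrArg adjoint h
  rw [ContinuousLinearMap.adjoint_comp, h1] at h2
  rw [map_smul, map_smulₛₗ, ContinuousLinearMap.comp_smul, h2]
  congr 1
  exact map_ofNat (starRingEnd ℂ) 2

theorem analyticAt_inverse_one_sub_apply [CompleteSpace E] (B : E →L[ℂ] E →L[ℂ] E) :
    AnalyticAt ℂ (fun Y => Ring.inverse (1 - B Y) Y) 0 := by
  have h1 : AnalyticAt ℂ (fun Y => Ring.inverse (1 - B Y)) 0 := by
    have h2 : AnalyticAt ℂ (Ring.inverse : (E →L[ℂ] E) → _) (1 - B 0) := by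
      have := analyticAt_inverse (𝕜 := ℂ) (1 : (E →L[ℂ] E)ˣ)
      simpa using this
    exact h2.fun_comp (f := fun Y => 1 - B Y) (analyticAt_const.sub (B.analyticAt _))
  exact AnalyticAt.comp₂ ((ContinuousLinearMap.id ℂ (E →L[ℂ] E)).analyticAt_bilinear _)
    h1 analyticAt_id

/-- Identity theorem for the composite with the quotient map modulo `S`. -/
theorem AnalyticOnNhd.mem_submodule_of_eventually_mem {V F : Type*} [NormedAddCommGroup V]
    [NormedSpace ℂ V] [NormedAddCommGroup F] [NormedSpace ℂ F] {f : V → F} {U : Set V}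
    (hf : AnalyticOnNhd ℂ f U) (hU : IsPreconnected U) {S : Submodule ℂ F}
    (hS : IsClosed (S : Set F)) {x : V} (hx : x ∈ U) (h : ∀ᶠ v in 𝓝 x, f v ∈ S) {v : V}
    (hv : v ∈ U) : f v ∈ S := by
  have hq : AnalyticOnNhd ℂ (fun v => S.mkQL (f v)) U :=
    fun v hv => (S.mkQL.analyticAt _).fun_comp (hf v hv)
  have := hq.eqOn_zero_of_preconnected_of_eventuallyEq_zero hU hx
    (h.mono fun v hv => (Submodule.Quotient.mk_eq_zero S).mpr hv) hv
  exact (Submodule.Quotient.mk_eq_zero S).mp this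

/-- The derivative of `ι ∘ f` is a limit of difference quotients in the closed range of `ι`, so it
factors through `ι`. -/
theorem differentiableAt_of_linearIsometry_comp {V E F : Type*} [NormedAddCommGroup V]
    [NormedSpace ℂ V] [NormedAddCommGroup E] [NormedSpace ℂ E] [CompleteSpace E]
    [NormedAddCommGroup F] [NormedSpace ℂ F] (ι : E →ₗᵢ[ℂ] F) {f : V → E} {x : V}
    (h : DifferentiableAt ℂ (fun v => ι (f v)) x) : DifferentiableAt ℂ f x := by
  obtain ⟨f', hf'⟩ := h
  have hcl : IsClosed (LinearMap.range ι.toLinearMap : Set F) :=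
    ι.isometry.isClosedEmbedding.isClosed_range
  have hmem : ∀ v, ∃ e, ι e = f' v := by
    intro v
    have h1 := (hf'.hasLineDerivAt v).tendsto_slope_zero
    exact hcl.mem_of_tendsto h1 (Eventually.of_forall fun t =>
      Submodule.smul_mem _ _ (Submodule.sub_mem _ ⟨_, rfl⟩ ⟨_, rfl⟩))
  choose g hg using hmem
  let G : V →ₗ[ℂ] E :=
    { toFun := g
      map_add' := fun _ _ => ι.injective (by simp [hg])
      map_smul' := fun _ _ => ι.injective (by simp [hg]) }
  have hG : ∀ v, ‖G v‖ ≤ ‖f'‖ * ‖v‖ := by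
    intro v
    rw [← ι.norm_map]
    exact (congrArg norm (hg v)).le.trans (f'.le_opNorm v)
  refine ⟨G.mkContinuous ‖f'‖ hG, ?_⟩
  rw [hasFDerivAt_iff_isLittleO_nhds_zero, ← Asymptotics.isLittleO_norm_left] at hf' ⊢
  refine hf'.congr_left fun v => ?_
  rw [← hg, ← map_sub, ← map_sub, ι.norm_map]
  rfl

theorem exists_symmetry_of_linearIsometry [CompleteSpace E]
    (hι : ∀ T S : E, ∃ X, ι X = (ι T).comp ((adjoint (ι S)).comp (ι T))) {w : E}
    (hw : w ∈ Metric.ball (0 : E) 1) : ∃ s : E → E, DifferentiableOn ℂ s (Metric.ball 0 1) ∧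
      MapsTo s (Metric.ball 0 1) (Metric.ball 0 1) ∧ AnalyticAt ℂ s w ∧ s w = w ∧
      HasFDerivAt s (-ContinuousLinearMap.id ℂ E) w := by
  have hnorm : ∀ Z ∈ Metric.ball (0 : E) 1, ‖ι Z‖ < 1 := fun Z hZ => by simpa using hZ
  have hw1 := hnorm w hw
  obtain ⟨y, hy⟩ := exists_comp_adjoint_eq hι (w := w) (by simpa using hw)
  obtain ⟨B, hB, hBn⟩ := exists_symm_triple hι y
  have hball : Metric.ball (0 : E) 1 ∈ 𝓝 w := Metric.isOpen_ball.mem_nhds hw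
  have hcl : IsClosed (LinearMap.range ι.toLinearMap : Set (H →L[ℂ] K)) :=
    ι.isometry.isClosedEmbedding.isClosed_range
  -- Near `w` the quasi-inverse is obtained by inverting `1 - B (Z - w)` on `E`, so `ballSymm` takes
  -- values in the range of `ι`. Analytic continuation extends this to the whole ball.
  have hlocal : ∀ᶠ Z in 𝓝 w,
      ballSymm (ι w) (ι Z) = ι (w - Ring.inverse (1 - B (Z - w)) (Z - w)) := by
    have hsmall : ∀ᶠ Z : E in 𝓝 w, ‖y‖ * ‖Z - w‖ < 1 := by
      have : ContinuousAt (fun Z : E => ‖y‖ * ‖Z - w‖) w := by fun_prop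
      exact this.eventually_lt continuousAt_const (by simp)
    filter_upwards [hsmall, hball] with Z hZs hZb
    rw [map_sub]
    refine ballSymm_eq_sub hw1 hy (hnorm Z hZb) ?_
    rw [← map_sub]
    exact comp_one_sub_eq_of_symm_triple hB hBn hZs
  have han : AnalyticOnNhd ℂ (fun Z => ballSymm (ι w) (ι Z)) (Metric.ball 0 1) := fun Z hZ =>
    (analyticAt_ballSymm (ι w) (hnorm Z hZ)).fun_comp
      (ι.toContinuousLinearMap.analyticAt Z)
  have hex : ∀ Z, ∃ X, Z ∈ Metric.ball (0 : E) 1 → ι X = ballSymm (ι w) (ι Z) := by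
    intro Z
    by_cases hZ : Z ∈ Metric.ball (0 : E) 1
    · obtain ⟨X, hX⟩ := han.mem_submodule_of_eventually_mem (convex_ball _ _).isPreconnected hcl
        hw (hlocal.mono fun Z h => ⟨_, h.symm⟩) hZ
      exact ⟨X, fun _ => hX⟩
    · exact ⟨0, fun h => absurd h hZ⟩
  choose s hs using hex
  have hsw : s w = w := ι.injective ((hs w hw).trans (ballSymm_self _))
  have hsa : AnalyticAt ℂ s w := by
    have h1 : AnalyticAt ℂ (fun Z => w - Ring.inverse (1 - B (Z - w)) (Z - w)) w := by
      refine analyticAt_const.sub (AnalyticAt.fun_comp (g := fun Y => Ring.inverse (1 - B Y) Y)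
        (f := fun Z => Z - w) ?_ (analyticAt_id.sub analyticAt_const))
      simpa using analyticAt_inverse_one_sub_apply B
    refine h1.congr ?_
    filter_upwards [hlocal, hball] with Z hZ hZb
    exact ι.injective (hZ.symm.trans (hs Z hZb).symm)
  refine ⟨s, fun Z hZ => ?_, fun Z hZ => ?_, hsa, hsw, ?_⟩
  · refine (differentiableAt_of_linearIsometry_comp ι ?_).differentiableWithinAt
    refine (han Z hZ).differentiableAt.congr_of_eventuallyEq ?_
    filter_upwards [Metric.isOpen_ball.mem_nhds hZ] with X hX using hs X hX
  · rw [mem_ball_zero_iff, ← ι.norm_map, hs Z hZ]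
    exact norm_ballSymm_lt_one hw1 (hnorm Z hZ)
  · have h1 := hsa.differentiableAt.hasFDerivAt
    have h2 : HasFDerivAt (fun Z => ι (s Z))
        ((-ContinuousLinearMap.id ℂ (H →L[ℂ] K)).comp ι.toContinuousLinearMap) w := by
      refine HasFDerivAt.congr_of_eventuallyEq (HasFDerivAt.comp w
        (f := ι.toContinuousLinearMap) (hasFDerivAt_ballSymm hw1)
        ι.toContinuousLinearMap.hasFDerivAt) ?_
      filter_upwards [hball] with X hX using hs X hX
    have h3 := (ι.toContinuousLinearMap.hasFDerivAt.comp w h1).unique h2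
    refine h1.congr_fderiv ?_
    ext1 v
    apply ι.injective
    simpa using congrArg (fun T : E →L[ℂ] (H →L[ℂ] K) => T v) h3

theorem IsJStarAlgebra.tetrablock_not_retract (hA : IsJStarAlgebra A) :
    ¬ IsAnalyticRetract tetrablock (Metric.ball (0 : A) 1) := by
  have : CompleteSpace A := hA.isClosed.completeSpace_coe
  exact tetrablock_not_retract_of_symmetric fun w hw =>
    exists_symmetry_of_linearIsometry (ι := A.subtypeₗᵢ)
      (fun T S => ⟨⟨_, hA.comp_adjoint_comp_mem T.2 S.2⟩, rfl⟩) hw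

end JStar

theorem theorem3p1 :
    (∀ (H : Type*) (K : Type*) [NormedAddCommGroup H] [InnerProductSpace ℂ H] [CompleteSpace H]
        [NormedAddCommGroup K] [InnerProductSpace ℂ K] [CompleteSpace K]
        (A : Submodule ℂ (H →L[ℂ] K)),
        IsJStarAlgebra A → jStarRank A < ⊤ →
          ¬ IsAnalyticRetract tetrablock (Metric.ball (0 : A) 1)) ∧
    (∀ (n : ℕ), n < 16 → ∀ Ω : Set (Fin n → ℂ), IsBoundedSymmetricDomain Ω →
        ¬ IsAnalyticRetract tetrablock Ω) :=
  ⟨fun _ _ _ _ _ _ _ _ _ hA _ => hA.tetrablock_not_retract,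
    fun _ _ _ hΩ => hΩ.tetrablock_not_retract⟩
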